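/- Let $S$ be a non-exceptional Riemann surface, that is, a connected Riemann surface with non-abelian fundamental group, and let $k\in\{2,3,\dots\}\cup\{\infty\}$. Let $U\to S$ be the universal covering (so $U\cong\mathbb H^2$), with deck group $\Gamma$, so that $S=U/\Gamma$. Let $\Gamma_k\le\Gamma$ be the subgroup generated by all commutators and, if $k\ne\infty$, all $k$-th powers of elements of $\Gamma$. Let $\widetilde S_k=U/\Gamma_k$ be the $k$-homology cover, $\pi_k:\widetilde S_k\to S$ the induced covering and $M_k\le\mathrm{Aut}(\widetilde S_k)$ its deck group. For $L\le\mathrm{Aut}(S)$, let $\widetilde L_k\le\mathrm{Aut}(\widetilde S_k)$ be the group of all lifts of elements of $L$, i.e. of all $\psi$ with $\pi_k\circ\psi=\phi\circ\pi_k$ for some $\phi\in L$, and let $\theta_k:\widetilde L_k\to L$, $\psi\mapsto\phi$, be the resulting homomorphism, whose kernel is $M_k$. Fix a presentation $\mathcal P$ of $L$ with generators $\{\phi_j\}_{j\in J}$ and relations $\{R_i(\{\phi_j\})=1\}_{i\in I}$, and fix $\psi_j\in\widetilde L_k$ with $\theta_k(\psi_j)=\phi_j$ for $j\in J$. Put $m_i=R_i(\{\psi_j\})\in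 M_k$, and let $N=M_{k,\mathcal P,\{\psi_j\}}$ be the smallest subgroup of $M_k$ that contains all the $m_i$ and is invariant under conjugation by $\widetilde L_k$. Then $N$ is contained in $\langle\psi_j: j\in J\rangle$; the quotient $W=\widetilde S_k/N$ is a Riemann surface and $\widetilde S_k\to W$ is a holomorphic covering; and the group $\mathcal G=\widetilde L_k/N$ acts faithfully on $W$ by conformal automorphisms, through the induced action (the class of $\psi$ sends the class of $x$ to the class of $\psi(x)$). Moreover, $\mathcal G$ is the internal semidirect product $$\mathcal G=\mathcal A\rtimes\hat L,\qquad \mathcal A=M_k/N,\quad \hat L=\langle\psi_j: j\in J\rangle/N,$$ that is, $\mathcal A$ is normal in $\mathcal G$, $\mathcal A\cap\hat L=1$ and $\mathcal A\hat L=\mathcal G$; and there is an isomorphism $\hat L\cong L$ sending the class of $\psi_j$ to $\phi_j$ for every $j\in J$. -/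

import Mathlib

open scoped Manifold ContDiff Topology

noncomputable section

namespace RSurf

/-- A Riemann surface: a connected Hausdorff one-dimensional complex manifold. -/
class RiemannSurface (X : Type*) [TopologicalSpace X] [ChartedSpace ℂ X] : Prop
    extends T2Space X, ConnectedSpace X, IsManifold 𝓘(ℂ) ω X

/-- A Riemann surface is non-exceptional if its fundamental group is not abelian. -/
def IsNonExceptional (X : Type*) [TopologicalSpace X] : Prop :=
  ∃ (x : X) (a b : FundamentalGroup X x), a * b ≠ b * a

section Automorphisms

variable (X : Type*) [TopologicalSpace X] [ChartedSpace ℂ X]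

/-- The biholomorphic self-maps, as a subgroup of the group of self-homeomorphisms. -/
def holAut : Subgroup (X ≃ₜ X) where
  carrier := {f | ContMDiff 𝓘(ℂ) 𝓘(ℂ) ω f ∧ ContMDiff 𝓘(ℂ) 𝓘(ℂ) ω f.symm}
  one_mem' := ⟨contMDiff_id, contMDiff_id⟩
  mul_mem' := fun hf hg => ⟨hf.1.comp hg.1, hg.2.comp hf.2⟩
  inv_mem' := fun hf => ⟨hf.2, hf.1⟩

/-- The group `Aut(X)` of conformal automorphisms of `X`. -/
abbrev HolAut : Type _ := ↥(holAut X)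

/-- The tautological action of `Aut(X)` on `X`. -/
instance holAutMulAction : MulAction (HolAut X) X where
  smul f x := f.1 x
  one_smul _ := rfl
  mul_smul _ _ _ := rfl

end Automorphisms

section OrbitSpaces

variable {X : Type*} [TopologicalSpace X] [ChartedSpace ℂ X]

/-- The quotient `X / H` by a group `H` of automorphisms, with the quotient topology. -/
def OrbitSpace (H : Subgroup (HolAut X)) : Type _ := Quotient (MulAction.orbitRel H X)

instance orbitSpaceTopology (H : Subgroup (HolAut X)) : TopologicalSpace (OrbitSpace H) :=
  inferInstanceAs (TopologicalSpace (Quotient (MulAction.orbitRel H X)))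

/-- The canonical projection `X → X / H`. -/
def orbitMk (H : Subgroup (HolAut X)) (x : X) : OrbitSpace H := Quotient.mk _ x

lemma orbitMk_surjective (H : Subgroup (HolAut X)) : Function.Surjective (orbitMk H) :=
  Quotient.mk_surjective

lemma orbitMk_eq_iff {H : Subgroup (HolAut X)} {x y : X} :
    orbitMk H x = orbitMk H y ↔ ∃ h ∈ H, h • y = x := by
  refine Quotient.eq.trans ?_
  rw [MulAction.orbitRel_apply, MulAction.mem_orbit_iff]
  exact ⟨fun ⟨h, e⟩ => ⟨h, h.2, e⟩, fun ⟨h, hh, e⟩ => ⟨⟨h, hh⟩, e⟩⟩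

/-- The groups of automorphisms for which `X → X / H` is a local homeomorphism. -/
class IsEtaleAction (H : Subgroup (HolAut X)) : Prop where
  isLocalHomeomorph : IsLocalHomeomorph (orbitMk H)

/-- The quotient complex structure on `X / H`: its charts are the local inverses of `X → X / H`
followed by charts of `X`. -/
instance orbitSpaceChartedSpace (H : Subgroup (HolAut X)) [IsEtaleAction H] : ChartedSpace ℂ (OrbitSpace H) :=
  IsEtaleAction.isLocalHomeomorph.chartedSpace (orbitMk_surjective H)

lemma isOpenMap_orbitMk (H : Subgroup (HolAut X)) : IsOpenMap (orbitMk H) := by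
  have : ContinuousConstSMul H X := ⟨fun h => h.1.1.continuous⟩
  exact isOpenMap_quotient_mk'_mul

/-- The deck group of a map `f : X → Y`: the automorphisms of `X` over `Y`. -/
def deckGroup {Y : Type*} (f : X → Y) : Subgroup (HolAut X) where
  carrier := {g | ∀ x, f (g • x) = f x}
  one_mem' := fun x => by rw [one_smul]
  mul_mem' := fun {a b} ha hb x => by rw [mul_smul, ha, hb]
  inv_mem' := fun {a} ha x => by rw [← ha (a⁻¹ • x), smul_inv_smul]

/-- If `f` is locally injective, every group of deck transformations of `f` acts étale-ly. -/
lemma isEtaleAction_of_le_deckGroup {Y : Type*} {f : X → Y} (hf : IsLocallyInjective f)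
    {H : Subgroup (HolAut X)} (hH : H ≤ deckGroup f) : IsEtaleAction H := by
  refine ⟨isLocalHomeomorph_iff_isOpenEmbedding_restrict.2 fun x => ?_⟩
  obtain ⟨V, hV, hx, hinj⟩ := hf x
  refine ⟨V, hV.mem_nhds hx, ?_⟩
  refine .of_continuous_injective_isOpenMap
    (continuous_quotient_mk'.comp continuous_subtype_val) ?_ ?_
  · rintro ⟨a, ha⟩ ⟨b, hb⟩ hab
    obtain ⟨h, hh, e⟩ := orbitMk_eq_iff.1 (show orbitMk H a = orbitMk H b from hab)
    exact Subtype.ext (hinj ha hb (by rw [← e]; exact hH hh b))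
  · exact (isOpenMap_orbitMk H).comp hV.isOpenMap_subtype_val

/-- If every element of `H` preserves `f`, then `f` descends to `X / H`. -/
def orbitLift {Y : Type*} (f : X → Y) (H : Subgroup (HolAut X)) (hH : H ≤ deckGroup f) :
    OrbitSpace H → Y :=
  Quotient.lift f fun a b hab => by
    obtain ⟨h, rfl⟩ := MulAction.orbitRel_apply.1 hab
    exact hH h.2 b

/-- The group of all lifts, along `f : X → Y`, of the elements of `L ≤ Aut(Y)`: those `ψ ∈ Aut(X)`
with `f ∘ ψ = φ ∘ f` for some `φ ∈ L`. -/
def liftGroup {Y : Type*} [TopologicalSpace Y] [ChartedSpace ℂ Y] (f : X → Y)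
    (L : Subgroup (HolAut Y)) : Subgroup (HolAut X) where
  carrier := {ψ | ∃ φ ∈ L, ∀ x, f (ψ • x) = φ • f x}
  one_mem' := ⟨1, L.one_mem, fun x => by rw [one_smul, one_smul]⟩
  mul_mem' := by
    rintro a b ⟨φ, hφ, ha⟩ ⟨χ, hχ, hb⟩
    exact ⟨φ * χ, L.mul_mem hφ hχ, fun x => by rw [mul_smul, mul_smul, ha, hb]⟩
  inv_mem' := by
    rintro a ⟨φ, hφ, ha⟩
    exact ⟨φ⁻¹, L.inv_mem hφ, fun x => by
      rw [eq_inv_smul_iff, ← ha, smul_inv_smul]⟩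

variable {Y : Type*} [TopologicalSpace Y] [ChartedSpace ℂ Y] {f : X → Y} {L : Subgroup (HolAut Y)}

lemma holAut_ext {a b : HolAut X} (h : ∀ x : X, a • x = b • x) : a = b :=
  Subtype.ext (Homeomorph.ext h)

/-- The homomorphism `θ` sending a lift `ψ` to the element `θ(ψ)` of `L` with
`f ∘ ψ = θ(ψ) ∘ f`. -/
def theta (hf : Function.Surjective f) (L : Subgroup (HolAut Y)) : liftGroup f L →* L :=
  MonoidHom.mk' (fun ψ => ⟨ψ.2.choose, ψ.2.choose_spec.1⟩) fun a b => by
    refine Subtype.ext (holAut_ext fun y => ?_)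
    obtain ⟨x, rfl⟩ := hf y
    have hab := (a * b).2.choose_spec.2 x
    have ha := a.2.choose_spec.2 (b.1 • x)
    have hb := b.2.choose_spec.2 x
    change (a * b).2.choose • f x = (a.2.choose * b.2.choose) • f x
    rw [← hab, mul_smul, ← hb, ← ha, ← mul_smul]
    rfl

lemma theta_spec (hf : Function.Surjective f) (ψ : liftGroup f L) (x : X) :
    f ((ψ : HolAut X) • x) = (theta hf L ψ : HolAut Y) • f x :=
  ψ.2.choose_spec.2 x

lemma mem_deckGroup_of_theta_eq_one (hf : Function.Surjective f) {ψ : liftGroup f L}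
    (h : theta hf L ψ = 1) : (ψ : HolAut X) ∈ deckGroup f := fun x => by
  rw [theta_spec hf, h, Subgroup.coe_one, one_smul]

lemma conj_mem_deckGroup {g n : HolAut X} (hg : g ∈ liftGroup f L) (hn : n ∈ deckGroup f) :
    g * n * g⁻¹ ∈ deckGroup f := fun x => by
  obtain ⟨φ, -, h⟩ := hg
  rw [mul_smul, mul_smul, h, hn, ← h, smul_inv_smul]

end OrbitSpaces

/-- A universal covering of Riemann surfaces `U → S`: a surjective holomorphic covering map from
a simply connected surface. -/
structure UniversalCovering (U S : Type*) [TopologicalSpace U] [ChartedSpace ℂ U]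
    [TopologicalSpace S] [ChartedSpace ℂ S] where
  toFun : U → S
  simplyConnected : SimplyConnectedSpace U
  isCoveringMap : IsCoveringMap toFun
  surjective : Function.Surjective toFun
  holomorphic : ContMDiff 𝓘(ℂ) 𝓘(ℂ) ω toFun

/-- For a group `Γ`, the subgroup `Γ_k` generated by the commutators of elements of `Γ` and, if
`k` is finite, by the `k`-th powers of elements of `Γ`. -/
def commPow {G : Type*} [Group G] (Γ : Subgroup G) (k : ℕ∞) : Subgroup G :=
  Subgroup.closure
    ({g | ∃ a ∈ Γ, ∃ b ∈ Γ, g = a * b * a⁻¹ * b⁻¹} ∪ {g | ∃ n : ℕ, k = n ∧ ∃ a ∈ Γ, g = a ^ n})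

lemma commPow_le {G : Type*} [Group G] (Γ : Subgroup G) (k : ℕ∞) : commPow Γ k ≤ Γ := by
  refine (Subgroup.closure_le _).2 ?_
  rintro g (⟨a, ha, b, hb, rfl⟩ | ⟨n, -, a, ha, rfl⟩)
  · exact Γ.mul_mem (Γ.mul_mem (Γ.mul_mem ha hb) (Γ.inv_mem ha)) (Γ.inv_mem hb)
  · exact Γ.pow_mem ha n

section HomologyCovers

variable {U S : Type*} [TopologicalSpace U] [ChartedSpace ℂ U]
  [TopologicalSpace S] [ChartedSpace ℂ S] (p : UniversalCovering U S) (k : ℕ∞)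

/-- The group `Γ` of deck transformations of the universal covering, so that `S = U / Γ`. -/
def fuchsian : Subgroup (HolAut U) := deckGroup p.toFun

instance isEtaleAction_commPow : IsEtaleAction (commPow (fuchsian p) k) :=
  isEtaleAction_of_le_deckGroup p.isCoveringMap.isLocalHomeomorph.isLocallyInjective
    (commPow_le _ k)

/-- The `k`-homology cover `U / Γ_k` of `S = U / Γ`. -/
abbrev HomologyCover : Type _ := OrbitSpace (commPow (fuchsian p) k)

/-- The covering `π_k : U / Γ_k → S` induced by the universal covering `U → S`. -/
def homologyProj : HomologyCover p k → S :=
  orbitLift p.toFun (commPow (fuchsian p) k) (commPow_le _ k)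

lemma homologyProj_surjective : Function.Surjective (homologyProj p k) := fun s => by
  obtain ⟨u, rfl⟩ := p.surjective s
  exact ⟨orbitMk _ u, rfl⟩

lemma homologyProj_isLocallyInjective : IsLocallyInjective (homologyProj p k) := fun w => by
  obtain ⟨u, rfl⟩ := orbitMk_surjective _ w
  obtain ⟨V, hV, hu, hinj⟩ := p.isCoveringMap.isLocalHomeomorph.isLocallyInjective u
  refine ⟨orbitMk _ '' V, isOpenMap_orbitMk _ V hV, ⟨u, hu, rfl⟩, ?_⟩
  rintro _ ⟨a, ha, rfl⟩ _ ⟨b, hb, rfl⟩ hab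
  exact congrArg _ (hinj ha hb hab)

/-- The deck group `M_k` of `π_k`. -/
def deckM : Subgroup (HolAut (HomologyCover p k)) := deckGroup (homologyProj p k)

/-- The group of all lifts to the `k`-homology cover of the elements of `L ≤ Aut(S)`. -/
def liftL (L : Subgroup (HolAut S)) : Subgroup (HolAut (HomologyCover p k)) :=
  liftGroup (homologyProj p k) L

/-- The homomorphism `θ_k`, characterized by `π_k ∘ ψ = θ_k(ψ) ∘ π_k`. -/
def thetaK (L : Subgroup (HolAut S)) : liftL p k L →* L :=
  theta (homologyProj_surjective p k) L

end HomologyCovers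

/-- A presentation of a group `L`: generators indexed by `J` and relators (words in the generators)
indexed by `I`, such that the kernel of the induced map from the free group is the normal closure
of the relators. -/
structure GroupPresentation (L J I : Type*) [Group L] where
  gen : J → L
  rel : I → FreeGroup J
  closure_gen : Subgroup.closure (Set.range gen) = ⊤
  ker_lift : (FreeGroup.lift gen).ker = Subgroup.normalClosure (Set.range rel)

section Relators

variable {U S : Type*} [TopologicalSpace U] [ChartedSpace ℂ U]
  [TopologicalSpace S] [ChartedSpace ℂ S] (p : UniversalCovering U S) (k : ℕ∞)
  {L : Subgroup (HolAut S)} {J I : Type*} (P : GroupPresentation L J I)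
  (ψ : J → liftL p k L) (hψ : ∀ j, thetaK p k L (ψ j) = P.gen j)

/-- The element `m_i = R_i({ψ_j}) ∈ M_k` obtained by evaluating the `i`-th relator at the lifts
`ψ_j` of the generators. -/
def relatorValue (i : I) : deckM p k :=
  ⟨(FreeGroup.lift ψ (P.rel i) : liftL p k L), by
    refine mem_deckGroup_of_theta_eq_one (homologyProj_surjective p k) ?_
    have h : (thetaK p k L).comp (FreeGroup.lift ψ) = FreeGroup.lift P.gen :=
      FreeGroup.ext_hom _ _ fun j => by
        rw [MonoidHom.comp_apply, FreeGroup.lift_apply_of, FreeGroup.lift_apply_of, hψ]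
    change ((thetaK p k L).comp (FreeGroup.lift ψ)) (P.rel i) = 1
    rw [h, ← MonoidHom.mem_ker, P.ker_lift]
    exact Subgroup.subset_normalClosure ⟨i, rfl⟩⟩

/-- The subgroups of `M_k` that are invariant under conjugation by all lifts of elements of `L`
and contain all the `m_i`. -/
def invariantSubgroups : Set (Subgroup (HolAut (HomologyCover p k))) :=
  {N | N ≤ deckM p k ∧ (∀ g ∈ liftL p k L, ∀ n ∈ N, g * n * g⁻¹ ∈ N) ∧
    ∀ i, (relatorValue p k P ψ hψ i : HolAut (HomologyCover p k)) ∈ N}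

/-- The smallest invariant subgroup of `M_k` containing all the `m_i`. -/
def relatorSubgroup : Subgroup (HolAut (HomologyCover p k)) :=
  sInf (invariantSubgroups p k P ψ hψ)

lemma relatorSubgroup_le : relatorSubgroup p k P ψ hψ ≤ deckM p k :=
  sInf_le ⟨le_rfl, fun _ hg _ hn => conj_mem_deckGroup hg hn,
    fun i => (relatorValue p k P ψ hψ i).2⟩

instance isEtaleAction_relatorSubgroup : IsEtaleAction (relatorSubgroup p k P ψ hψ) :=
  isEtaleAction_of_le_deckGroup (homologyProj_isLocallyInjective p k)
    (relatorSubgroup_le p k P ψ hψ)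

/-- The quotient surface `W` of the `k`-homology cover by the relator subgroup. -/
abbrev QuotientSurface : Type _ := OrbitSpace (relatorSubgroup p k P ψ hψ)

/-- The relator subgroup, inside the group of lifts of `L`. -/
def relatorN : Subgroup (liftL p k L) := (relatorSubgroup p k P ψ hψ).subgroupOf (liftL p k L)

instance relatorN_normal : (relatorN p k P ψ hψ).Normal where
  conj_mem := fun n hn g => by
    rw [relatorN, Subgroup.mem_subgroupOf] at hn ⊢
    refine Subgroup.mem_sInf.2 fun N hN => ?_
    exact hN.2.1 g g.2 n (Subgroup.mem_sInf.1 hn N hN)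

/-- The quotient group `G` of the group of lifts of `L` by the relator subgroup. -/
abbrev QuotientGroupG : Type _ := liftL p k L ⧸ relatorN p k P ψ hψ

/-- The image `A` of `M_k` in `G`. -/
def subgroupA : Subgroup (QuotientGroupG p k P ψ hψ) :=
  ((deckM p k).subgroupOf (liftL p k L)).map (QuotientGroup.mk' (relatorN p k P ψ hψ))

/-- The image of `⟨ψ_j : j ∈ J⟩` in `G`. -/
def subgroupLhat : Subgroup (QuotientGroupG p k P ψ hψ) :=
  (Subgroup.closure (Set.range ψ)).map (QuotientGroup.mk' (relatorN p k P ψ hψ))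

end Relators

end RSurf

end

open RSurf

/-! Write `B` for the subgroup generated by the `ψ_j`. The heart of the matter is that `N = M_k ∩
B`. For `⊆`: `M_k` is abelian (`commute_of_mem_deckM`), because its elements lift to the simply
connected `U`, the lifts lie in `Γ`, and their commutators lie in `Γ_k`. Since `B` maps onto `L`,
every lift of an element of `L` is `b * m` with `b ∈ B` and `m ∈ M_k`; `m` centralizes `M_k ∩ B`, so
this intersection is invariant under all lifts. It contains the `m_i`, hence also `N`
(`relatorN_le_closure`). For `⊇`: an element of `M_k ∩ B` is the value at the `ψ_j` of a word that
is trivial in `L`, thus of a word in the normal closure of the relators; its value lies in `N`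
(`ker_inf_closure_le`). The splitting is then formal: modulo `N`, the map `θ_k` has kernel `A` and
restricts to an isomorphism from `B / N` onto `L`. On the geometric side, deck transformations over
`S` are determined by one value, so `N` acts as a covering action; `W` is Hausdorff because it lies
over `S`, and its charts come from local inverses of the projection. -/

namespace RSurf

/-! ### Topology of quotients by groups of deck transformations -/

section Topology

variable {X : Type*} [TopologicalSpace X] [ChartedSpace ℂ X]

lemma continuous_holAut_smul (g : HolAut X) : Continuous fun x : X => g • x :=
  g.1.continuous

lemma contMDiff_holAut_smul (g : HolAut X) : ContMDiff 𝓘(ℂ) 𝓘(ℂ) ω fun x : X => g • x :=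
  g.2.1

lemma continuous_orbitMk (H : Subgroup (HolAut X)) : Continuous (orbitMk H) :=
  continuous_quotient_mk'

lemma isQuotientMap_orbitMk (H : Subgroup (HolAut X)) : Topology.IsQuotientMap (orbitMk H) :=
  isQuotientMap_quotient_mk'

lemma orbitMk_smul {H : Subgroup (HolAut X)} {h : HolAut X} (hh : h ∈ H) (x : X) :
    orbitMk H (h • x) = orbitMk H x :=
  orbitMk_eq_iff.2 ⟨h, hh, rfl⟩

instance orbitSpace_connectedSpace [ConnectedSpace X] (H : Subgroup (HolAut X)) :
    ConnectedSpace (OrbitSpace H) :=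
  (orbitMk_surjective H).connectedSpace (continuous_orbitMk H)

/-- Deck transformations of a locally injective map on a connected Hausdorff space are determined
by their value at a point. -/
lemma eq_of_mem_deckGroup [T2Space X] [PreconnectedSpace X] {Y : Type*} {f : X → Y}
    (hf : IsLocallyInjective f) {a b : HolAut X} (ha : a ∈ deckGroup f) (hb : b ∈ deckGroup f)
    {x : X} (h : a • x = b • x) : a = b :=
  holAut_ext <| congrFun <| (T2Space.isSeparatedMap f).eq_of_comp_eq hf
    (continuous_holAut_smul a) (continuous_holAut_smul b)
    (funext fun z => (ha z).trans (hb z).symm) x h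

/-- A group of deck transformations of a locally injective map on a connected Hausdorff space
acts as a covering space action. -/
lemma isCoveringMap_orbitMk [T2Space X] [PreconnectedSpace X] {Y : Type*} {f : X → Y}
    (hf : IsLocallyInjective f) {H : Subgroup (HolAut X)} (hH : H ≤ deckGroup f) :
    IsCoveringMap (orbitMk H) := by
  suffices IsQuotientCoveringMap (orbitMk H) H from this.isCoveringMap
  exact
    { isQuotientMap_orbitMk H with
      continuous_const_smul := fun h => continuous_holAut_smul h.1
      apply_eq_iff_mem_orbit := Quotient.eq.trans MulAction.orbitRel_apply
      disjoint := fun x => by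
        obtain ⟨V, hV, hx, hinj⟩ := hf x
        refine ⟨V, hV.mem_nhds hx, ?_⟩
        -- If `V` meets its translate by `h`, injectivity of `f` on `V` gives `h` a fixed point, and
        -- by rigidity `h = 1`.
        rintro ⟨h, hh⟩ ⟨_, ⟨z, hz, rfl⟩, hz'⟩
        have e : h • z = z := hinj hz' hz (hH hh z)
        exact Subtype.ext (eq_of_mem_deckGroup hf (hH hh) (one_mem _)
          (e.trans (one_smul (HolAut X) z).symm)) }

/-- The quotient of a Hausdorff space by a group of deck transformations of a local homeomorphism
to a locally connected Hausdorff space is Hausdorff. -/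
lemma t2Space_orbitSpace [T2Space X] {Y : Type*} [TopologicalSpace Y] [T2Space Y]
    [LocallyConnectedSpace Y] {f : X → Y} (hf : IsLocalHomeomorph f)
    {H : Subgroup (HolAut X)} (hH : H ≤ deckGroup f) : T2Space (OrbitSpace H) := by
  refine ⟨fun w w' hne => ?_⟩
  obtain ⟨x, rfl⟩ := orbitMk_surjective H w
  obtain ⟨x', rfl⟩ := orbitMk_surjective H w'
  by_cases hxx : f x = f x'
  -- Two points of one fibre are separated by the sheets through them over a common connected `V`.
  · obtain ⟨V, ⟨hVo, hxV, hVc⟩, hV⟩ := (LocallyConnectedSpace.open_connected_basis (f x)).mem_iff.1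
      (Filter.inter_mem
        ((hf.localInverseAt x).open_source.mem_nhds hf.apply_self_mem_localInverseAt_source)
        ((hf.localInverseAt x').open_source.mem_nhds
          (hxx ▸ hf.apply_self_mem_localInverseAt_source)))
    obtain ⟨hV₁, hV₂⟩ := Set.subset_inter_iff.1 hV
    refine ⟨orbitMk H '' (hf.localInverseAt x '' V), orbitMk H '' (hf.localInverseAt x' '' V),
      isOpenMap_orbitMk H _ ((hf.localInverseAt x).isOpen_image_of_subset_source hVo hV₁),
      isOpenMap_orbitMk H _ ((hf.localInverseAt x').isOpen_image_of_subset_source hVo hV₂),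
      ⟨x, ⟨f x, hxV, hf.localInverseAt_apply_self⟩, rfl⟩,
      ⟨x', ⟨f x, hxV, by rw [hxx]; exact hf.localInverseAt_apply_self⟩, rfl⟩, ?_⟩
    rw [Set.disjoint_left]
    rintro _ ⟨_, ⟨v, hv, rfl⟩, rfl⟩ ⟨_, ⟨v', hv', rfl⟩, e⟩
    obtain ⟨h, hh, e⟩ := orbitMk_eq_iff.1 e
    have hvv : v = v' := by
      have := congrArg f e
      rwa [hH hh, hf.apply_localInverseAt_of_mem (hV₁ hv),
        hf.apply_localInverseAt_of_mem (hV₂ hv')] at this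
    subst hvv
    -- If the sheets met modulo `H`, some `h` would agree with a change of sheet at one point of
    -- `V`, hence on all of the connected `V`; then `h • x = x'`, against `hne`.
    have key := (T2Space.isSeparatedMap f).eqOn_of_comp_eqOn hf.isLocallyInjective
      hVc.isPreconnected
      ((continuous_holAut_smul h).comp_continuousOn ((hf.localInverseAt x).continuousOn.mono hV₁))
      ((hf.localInverseAt x').continuousOn.mono hV₂)
      (fun z hz => by
        simp only [Function.comp_apply]
        rw [hH hh, hf.apply_localInverseAt_of_mem (hV₁ hz),
          hf.apply_localInverseAt_of_mem (hV₂ hz)]) hv e hxV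
    have e₁ : hf.localInverseAt x (f x) = x := hf.localInverseAt_apply_self
    have e₂ : hf.localInverseAt x' (f x) = x' := by rw [hxx]; exact hf.localInverseAt_apply_self
    rw [Function.comp_apply, e₁, e₂] at key
    exact hne (orbitMk_eq_iff.2 ⟨h⁻¹, H.inv_mem hh, by rw [← key, inv_smul_smul]⟩)
  · obtain ⟨A, B, hA, hB, hxA, hxB, hAB⟩ := t2_separation hxx
    have hc : Continuous (orbitLift f H hH) := hf.continuous.quotient_lift _
    exact ⟨_, _, hA.preimage hc, hB.preimage hc, hxA, hxB, hAB.preimage _⟩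

/-- The map induced on the quotient by a group of deck transformations of a local homeomorphism is
a local homeomorphism. -/
lemma isLocalHomeomorph_orbitLift {Y : Type*} [TopologicalSpace Y] {f : X → Y}
    (hf : IsLocalHomeomorph f) {H : Subgroup (HolAut X)} (hH : H ≤ deckGroup f) :
    IsLocalHomeomorph (orbitLift f H hH) := by
  have hc : Continuous (orbitLift f H hH) := hf.continuous.quotient_lift _
  refine isLocalHomeomorph_iff_isOpenEmbedding_restrict.2 fun w => ?_
  obtain ⟨x, rfl⟩ := orbitMk_surjective H w
  obtain ⟨V, hV, hx, hinj⟩ := hf.isLocallyInjective x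
  have hO : IsOpen (orbitMk H '' V) := isOpenMap_orbitMk H V hV
  refine ⟨orbitMk H '' V, hO.mem_nhds ⟨x, hx, rfl⟩, ?_⟩
  refine .of_continuous_injective_isOpenMap (hc.comp continuous_subtype_val) ?_ ?_
  · rintro ⟨_, a, ha, rfl⟩ ⟨_, b, hb, rfl⟩ hab
    exact Subtype.ext (congrArg (orbitMk H) (hinj ha hb hab))
  · refine IsOpenMap.comp (fun O hO => ?_) hO.isOpenMap_subtype_val
    have : orbitLift f H hH '' O = f '' (orbitMk H ⁻¹' O) := by
      ext y
      constructor
      · rintro ⟨w, hw, rfl⟩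
        obtain ⟨x, rfl⟩ := orbitMk_surjective H w
        exact ⟨x, hw, rfl⟩
      · rintro ⟨x, hx, rfl⟩
        exact ⟨_, hx, rfl⟩
    rw [this]
    exact hf.isOpenMap _ (hO.preimage (continuous_orbitMk H))

end Topology

end RSurf

namespace RSurf

/-! ### The complex structure on an orbit space -/

section ComplexStructure

variable {X : Type*} [TopologicalSpace X] [ChartedSpace ℂ X]

/-- Near a point, a local inverse of `X → X / H` composed with the projection is the action of an
element of `H`. -/
lemma exists_localInverseAt_orbitMk_eventuallyEq (H : Subgroup (HolAut X)) [hH : IsEtaleAction H]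
    {q x : X} (hx : orbitMk H x ∈ (hH.isLocalHomeomorph.localInverseAt q).source) :
    ∃ h ∈ H, ∀ᶠ z in 𝓝 x, hH.isLocalHomeomorph.localInverseAt q (orbitMk H z) = h • z := by
  set s := hH.isLocalHomeomorph.localInverseAt q with hs
  obtain ⟨h, hh, e⟩ := orbitMk_eq_iff.1 (hH.isLocalHomeomorph.apply_localInverseAt_of_mem hx)
  refine ⟨h, hh, ?_⟩
  have h₁ : ∀ᶠ z in 𝓝 x, orbitMk H z ∈ s.source :=
    (continuous_orbitMk H).continuousAt.eventually (s.open_source.mem_nhds hx)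
  have h₂ : ∀ᶠ z in 𝓝 x, h • z ∈ s.target :=
    (continuous_holAut_smul h).continuousAt.eventually
      (s.open_target.mem_nhds (show h • x ∈ s.target by rw [e]; exact s.map_source hx))
  filter_upwards [h₁, h₂] with z hz₁ hz₂
  refine hH.isLocalHomeomorph.injOn_localInverseAt_target (s.map_source hz₁) hz₂ ?_
  rw [hH.isLocalHomeomorph.apply_localInverseAt_of_mem hz₁, orbitMk_smul hh]

/-- The representative of a point of `X / H` used to define the preferred chart at that point. -/
noncomputable def orbitRep (H : Subgroup (HolAut X)) : OrbitSpace H → X :=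
  (orbitMk_surjective H).hasRightInverse.choose

lemma orbitMk_orbitRep (H : Subgroup (HolAut X)) (w : OrbitSpace H) :
    orbitMk H (orbitRep H w) = w :=
  (orbitMk_surjective H).hasRightInverse.choose_spec w

lemma chartAt_orbitSpace (H : Subgroup (HolAut X)) [hH : IsEtaleAction H] (w : OrbitSpace H) :
    chartAt ℂ w = (hH.isLocalHomeomorph.localInverseAt (orbitRep H w)).trans
      (chartAt ℂ (orbitRep H w)) :=
  rfl

/-- Near each point a transition map is a chart of `X`, preceded by some `h ∈ H` and the inverse of
another chart, and `h` is holomorphic. -/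
instance orbitSpace_isManifold [IsManifold 𝓘(ℂ) ω X] (H : Subgroup (HolAut X)) [hH : IsEtaleAction H] :
    IsManifold 𝓘(ℂ) ω (OrbitSpace H) := by
  refine isManifold_of_contDiffOn 𝓘(ℂ) ω _ ?_
  rintro _ _ ⟨w, rfl⟩ ⟨w', rfl⟩
  intro t ht
  replace ht : t ∈ ((chartAt ℂ w).symm.trans (chartAt ℂ w')).source := ht.1
  refine ContDiffAt.contDiffWithinAt ?_
  rw [← contMDiffAt_iff_contDiffAt]
  set q := orbitRep H w
  set q' := orbitRep H w'
  have hsymm : ∀ u, (chartAt ℂ w).symm u = orbitMk H ((chartAt ℂ q).symm u) := fun u =>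
    congrFun (hH.isLocalHomeomorph.localInverseAt_symm q) ((chartAt ℂ q).symm u)
  have ht₁ : t ∈ (chartAt ℂ q).target := ht.1.1
  have ht₂ : (chartAt ℂ w).symm t ∈ (chartAt ℂ w').source := ht.2
  rw [hsymm] at ht₂
  obtain ⟨h, -, he⟩ := exists_localInverseAt_orbitMk_eventuallyEq H (q := q') ht₂.1
  have ht₃ : h • (chartAt ℂ q).symm t ∈ (chartAt ℂ q').source := by
    rw [← he.self_of_nhds]
    exact ht₂.2
  have hsm : ContMDiffAt 𝓘(ℂ) 𝓘(ℂ) ω (chartAt ℂ q).symm t :=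
    contMDiffOn_chart_symm.contMDiffAt ((chartAt ℂ q).open_target.mem_nhds ht₁)
  have hch : ContMDiffAt 𝓘(ℂ) 𝓘(ℂ) ω (chartAt ℂ q') (h • (chartAt ℂ q).symm t) :=
    contMDiffOn_chart.contMDiffAt ((chartAt ℂ q').open_source.mem_nhds ht₃)
  have hcomp : ContMDiffAt 𝓘(ℂ) 𝓘(ℂ) ω
      (fun u => chartAt ℂ q' (h • (chartAt ℂ q).symm u)) t :=
    ContMDiffAt.comp t (f := fun u => h • (chartAt ℂ q).symm u) hch
      ((contMDiff_holAut_smul h).contMDiffAt.comp t hsm)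
  refine hcomp.congr_of_eventuallyEq ?_
  filter_upwards [hsm.continuousAt.eventually he] with u hu
  rw [← hu, ← hsymm]
  rfl

/-- In the preferred chart at its value, the projection is locally some `h ∈ H` followed by a chart
of `X`. -/
lemma contMDiff_orbitMk (H : Subgroup (HolAut X)) [hH : IsEtaleAction H] :
    ContMDiff 𝓘(ℂ) 𝓘(ℂ) ω (orbitMk H) := by
  intro x
  rw [contMDiffAt_iff_target]
  refine ⟨(continuous_orbitMk H).continuousAt, ?_⟩
  set q := orbitRep H (orbitMk H x) with hq
  have hsrc : orbitMk H x ∈ (hH.isLocalHomeomorph.localInverseAt q).source := by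
    nth_rw 1 [← orbitMk_orbitRep H (orbitMk H x)]
    exact hH.isLocalHomeomorph.apply_self_mem_localInverseAt_source
  obtain ⟨h, hh, he⟩ := exists_localInverseAt_orbitMk_eventuallyEq H hsrc
  have hhx : h • x = q := by
    rw [← he.self_of_nhds]
    nth_rw 1 [← orbitMk_orbitRep H (orbitMk H x)]
    exact hH.isLocalHomeomorph.localInverseAt_apply_self
  have hc : ContMDiffAt 𝓘(ℂ) 𝓘(ℂ) ω (fun z => extChartAt 𝓘(ℂ) q (h • z)) x :=
    ContMDiffAt.comp x (g := extChartAt 𝓘(ℂ) q) (f := fun z => h • z)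
      (by rw [hhx]; exact contMDiffAt_extChartAt) (contMDiff_holAut_smul h x)
  refine hc.congr_of_eventuallyEq ?_
  filter_upwards [he] with z hz
  rw [← hz]
  rfl

/-- A map out of `X / H` is holomorphic if its composition with `X → X / H` is. -/
lemma contMDiffAt_of_comp_orbitMk {Z : Type*} [TopologicalSpace Z] [ChartedSpace ℂ Z]
    (H : Subgroup (HolAut X)) [hH : IsEtaleAction H] {f : OrbitSpace H → Z} {x : X}
    (hf : ContMDiffAt 𝓘(ℂ) 𝓘(ℂ) ω (fun z => f (orbitMk H z)) x) :
    ContMDiffAt 𝓘(ℂ) 𝓘(ℂ) ω f (orbitMk H x) := by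
  obtain ⟨h, hh, e⟩ := orbitMk_eq_iff.1 (orbitMk_orbitRep H (orbitMk H x)).symm
  set w := orbitMk H x with hw
  -- The chart at the orbit is built from `orbitRep`, which may differ from `x`; `H`-invariance
  -- transports the hypothesis from `x` to it.
  have hrep : ContMDiffAt 𝓘(ℂ) 𝓘(ℂ) ω (fun z => f (orbitMk H z)) (orbitRep H w) := by
    have : (fun z => f (orbitMk H z)) = fun z => f (orbitMk H (h • z)) :=
      funext fun z => by rw [orbitMk_smul hh]
    rw [this]
    exact ContMDiffAt.comp (orbitRep H w) (g := fun z => f (orbitMk H z)) (f := fun z => h • z)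
      (by rw [e]; exact hf) (contMDiff_holAut_smul h _)
  rw [contMDiffAt_iff_source]
  have hval : extChartAt 𝓘(ℂ) w w = extChartAt 𝓘(ℂ) (orbitRep H w) (orbitRep H w) := by
    have : hH.isLocalHomeomorph.localInverseAt (orbitRep H w) w = orbitRep H w := by
      nth_rw 2 [← orbitMk_orbitRep H w]
      exact hH.isLocalHomeomorph.localInverseAt_apply_self
    change chartAt ℂ (orbitRep H w) (hH.isLocalHomeomorph.localInverseAt (orbitRep H w) w) = _
    rw [this]
    rfl
  have hsymm : f ∘ (extChartAt 𝓘(ℂ) w).symm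
      = (fun z => f (orbitMk H z)) ∘ (extChartAt 𝓘(ℂ) (orbitRep H w)).symm := by
    funext t
    change f ((hH.isLocalHomeomorph.localInverseAt (orbitRep H w)).symm _) = _
    rw [hH.isLocalHomeomorph.localInverseAt_symm]
    rfl
  rw [hsymm, hval]
  exact contMDiffAt_iff_source.1 hrep

/-- A continuous lift of a holomorphic map along `X → X / H` is holomorphic. -/
lemma contMDiff_of_orbitMk_comp {Z : Type*} [TopologicalSpace Z] [ChartedSpace ℂ Z]
    (H : Subgroup (HolAut X)) [hH : IsEtaleAction H] {g : Z → X} (hg : Continuous g)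
    (hgf : ContMDiff 𝓘(ℂ) 𝓘(ℂ) ω fun z => orbitMk H (g z)) :
    ContMDiff 𝓘(ℂ) 𝓘(ℂ) ω g := by
  intro z
  set s := hH.isLocalHomeomorph.localInverseAt (g z) with hs
  have hsg : ∀ᶠ x in 𝓝 (g z), s (orbitMk H x) = x := by
    filter_upwards [s.open_target.mem_nhds hH.isLocalHomeomorph.self_mem_localInverseAt_target]
      with x hx
    have := s.right_inv hx
    rwa [hH.isLocalHomeomorph.localInverseAt_symm] at this
  -- The local inverse `s` is holomorphic since it composes with the projection to the identity;
  -- near `z`, `g` is `s` after the holomorphic map `orbitMk H ∘ g`.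
  have hsm : ContMDiffAt 𝓘(ℂ) 𝓘(ℂ) ω s (orbitMk H (g z)) :=
    contMDiffAt_of_comp_orbitMk H (contMDiffAt_id.congr_of_eventuallyEq hsg)
  exact (ContMDiffAt.comp z hsm (hgf z)).congr_of_eventuallyEq
    ((hg.continuousAt.eventually hsg).mono fun y hy => hy.symm)

end ComplexStructure

end RSurf

namespace RSurf

/-! ### Lifting automorphisms to a simply connected cover; commutativity of deck groups -/

section Lifting

variable {X : Type*} [TopologicalSpace X] [ChartedSpace ℂ X]

/-- Automorphisms of a quotient lift to a simply connected covering surface. -/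
lemma exists_lift_of_simplyConnected [T2Space X] [SimplyConnectedSpace X]
    (H : Subgroup (HolAut X)) [IsEtaleAction H] (hcov : IsCoveringMap (orbitMk H))
    (φ : HolAut (OrbitSpace H)) :
    ∃ g : HolAut X, ∀ u, orbitMk H (g • u) = φ • orbitMk H u := by
  have : LocallyPathConnectedSpace X := ChartedSpace.locallyPathConnectedSpace ℂ X
  obtain ⟨u₀⟩ : Nonempty X := inferInstance
  obtain ⟨v₀, hv₀⟩ := orbitMk_surjective H (φ • orbitMk H u₀)
  have lifts (χ : HolAut (OrbitSpace H)) (a b : X) (h : orbitMk H b = χ • orbitMk H a) :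
      ∃ F : C(X, X), F a = b ∧ ∀ u, orbitMk H (F u) = χ • orbitMk H u := by
    obtain ⟨F, ⟨hF, hF'⟩, -⟩ := hcov.existsUnique_continuousMap_lifts
      ⟨fun u => χ • orbitMk H u, (continuous_holAut_smul χ).comp (continuous_orbitMk H)⟩ a b h
    exact ⟨F, hF, congrFun hF'⟩
  have uniq (F : C(X, X)) (a : X) (ha : F a = a) (hF : ∀ u, orbitMk H (F u) = orbitMk H u)
      (u : X) : F u = u :=
    congrFun ((T2Space.isSeparatedMap (orbitMk H)).eq_of_comp_eq
      hcov.isLocalHomeomorph.isLocallyInjective F.continuous continuous_id (funext hF) a ha) u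
  -- Base points are exchanged, so that both composites of `F` and `F₁` lift the identity and fix a
  -- point, hence are the identity.
  obtain ⟨F, hF, hF'⟩ := lifts φ u₀ v₀ hv₀
  obtain ⟨F₁, hF₁, hF₁'⟩ := lifts φ⁻¹ v₀ u₀ (by rw [hv₀, inv_smul_smul])
  have holo (χ : HolAut (OrbitSpace H)) (F : C(X, X))
      (hF : ∀ u, orbitMk H (F u) = χ • orbitMk H u) : ContMDiff 𝓘(ℂ) 𝓘(ℂ) ω F := by
    refine contMDiff_of_orbitMk_comp H F.continuous ?_
    simp only [hF]
    exact (contMDiff_holAut_smul χ).comp (contMDiff_orbitMk H)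
  let g : X ≃ₜ X :=
    { toFun := F
      invFun := F₁
      left_inv := uniq (F₁.comp F) u₀ (by rw [ContinuousMap.comp_apply, hF, hF₁]) fun u => by
        rw [ContinuousMap.comp_apply, hF₁', hF', inv_smul_smul]
      right_inv := uniq (F.comp F₁) v₀ (by rw [ContinuousMap.comp_apply, hF₁, hF]) fun u => by
        rw [ContinuousMap.comp_apply, hF', hF₁', smul_inv_smul]
      continuous_toFun := F.continuous
      continuous_invFun := F₁.continuous }
  exact ⟨⟨g, holo φ F hF', holo φ⁻¹ F₁ hF₁'⟩, hF'⟩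

/-- The deck group of an abelian cover, presented as a quotient of the universal cover by a
subgroup `H` containing the commutators of the deck group of `f`, is abelian. -/
lemma commute_of_mem_deckGroup_orbitLift [T2Space X] [SimplyConnectedSpace X] {Y : Type*}
    {f : X → Y} {H : Subgroup (HolAut X)} [IsEtaleAction H] (hH : H ≤ deckGroup f)
    (hcov : IsCoveringMap (orbitMk H))
    (hcomm : ∀ a ∈ deckGroup f, ∀ b ∈ deckGroup f, a * b * a⁻¹ * b⁻¹ ∈ H)
    {a b : HolAut (OrbitSpace H)} (ha : a ∈ deckGroup (orbitLift f H hH))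
    (hb : b ∈ deckGroup (orbitLift f H hH)) : a * b = b * a := by
  have deck {χ : HolAut (OrbitSpace H)} (hχ : χ ∈ deckGroup (orbitLift f H hH)) {g : HolAut X}
      (hg : ∀ u, orbitMk H (g • u) = χ • orbitMk H u) : g ∈ deckGroup f := fun u => by
    have := hχ (orbitMk H u)
    rw [← hg] at this
    exact this
  obtain ⟨g, hg⟩ := exists_lift_of_simplyConnected H hcov a
  obtain ⟨h, hh⟩ := exists_lift_of_simplyConnected H hcov b
  refine holAut_ext fun w => ?_
  obtain ⟨u, rfl⟩ := orbitMk_surjective H w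
  -- The lifts `g` and `h` commute up to a commutator, which lies in `H` and so is invisible in the
  -- quotient.
  have key : g * h = (g * h * g⁻¹ * h⁻¹) * (h * g) := by group
  rw [mul_smul, mul_smul, ← hh, ← hg, ← hg, ← hh, ← mul_smul, ← mul_smul, key, mul_smul,
    orbitMk_smul (hcomm g (deck ha hg) h (deck hb hh))]

end Lifting

/-! ### Descent of normalizing automorphisms to `X / N` -/

section Descent

variable {X : Type*} [TopologicalSpace X] [ChartedSpace ℂ X]
  {K N : Subgroup (HolAut X)} (hKN : ∀ g ∈ K, ∀ n ∈ N, g * n * g⁻¹ ∈ N)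

/-- The map induced on `X / N` by an automorphism `g` of `X` normalizing `N`. -/
def orbitMap (g : K) : OrbitSpace N → OrbitSpace N :=
  Quotient.lift (fun x => orbitMk N ((g : HolAut X) • x)) fun a b hab => by
    obtain ⟨n, rfl⟩ := MulAction.orbitRel_apply.1 hab
    refine orbitMk_eq_iff.2 ⟨_, hKN g g.2 n n.2, ?_⟩
    rw [mul_smul, mul_smul, inv_smul_smul]
    rfl

lemma orbitMap_mk (g : K) (x : X) :
    orbitMap hKN g (orbitMk N x) = orbitMk N ((g : HolAut X) • x) :=
  rfl

lemma continuous_orbitMap (g : K) : Continuous (orbitMap hKN g) :=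
  ((continuous_orbitMk N).comp (continuous_holAut_smul (g : HolAut X))).quotient_lift _

lemma orbitMap_mul (g h : K) (w : OrbitSpace N) :
    orbitMap hKN (g * h) w = orbitMap hKN g (orbitMap hKN h w) := by
  obtain ⟨x, rfl⟩ := orbitMk_surjective N w
  simp only [orbitMap_mk, Subgroup.coe_mul, mul_smul]

lemma orbitMap_one (w : OrbitSpace N) : orbitMap hKN 1 w = w := by
  obtain ⟨x, rfl⟩ := orbitMk_surjective N w
  rw [orbitMap_mk, Subgroup.coe_one, one_smul]

variable [IsEtaleAction N]

lemma contMDiff_orbitMap (g : K) : ContMDiff 𝓘(ℂ) 𝓘(ℂ) ω (orbitMap hKN g) := by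
  intro w
  obtain ⟨x, rfl⟩ := orbitMk_surjective N w
  exact contMDiffAt_of_comp_orbitMk N
    ((contMDiff_orbitMk N).comp (contMDiff_holAut_smul (g : HolAut X)) x)

/-- The action on `X / N` of a group of automorphisms normalizing `N`. -/
def descend : K →* HolAut (OrbitSpace N) where
  toFun g :=
    ⟨{ toFun := orbitMap hKN g
       invFun := orbitMap hKN g⁻¹
       left_inv := fun w => by rw [← orbitMap_mul, inv_mul_cancel, orbitMap_one]
       right_inv := fun w => by rw [← orbitMap_mul, mul_inv_cancel, orbitMap_one]
       continuous_toFun := continuous_orbitMap hKN g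
       continuous_invFun := continuous_orbitMap hKN g⁻¹ },
      contMDiff_orbitMap hKN g, contMDiff_orbitMap hKN g⁻¹⟩
  map_one' := holAut_ext fun w => (orbitMap_one hKN w).trans (one_smul _ w).symm
  map_mul' g h := holAut_ext fun w => by
    rw [mul_smul]
    exact orbitMap_mul hKN g h w

lemma descend_smul_orbitMk (g : K) (x : X) :
    descend hKN g • orbitMk N x = orbitMk N ((g : HolAut X) • x) :=
  rfl

lemma descend_eq_one_of_mem {g : K} (hg : (g : HolAut X) ∈ N) : descend hKN g = 1 :=
  holAut_ext fun w => by
    obtain ⟨x, rfl⟩ := orbitMk_surjective N w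
    rw [descend_smul_orbitMk, orbitMk_smul hg, one_smul]

/-- This gives faithfulness: a `g` preserving every `N`-orbit preserves the fibres of `f`, so it is
a deck transformation; it agrees with some `n ∈ N` at one point, hence everywhere. -/
lemma mem_of_descend_eq_one [T2Space X] [ConnectedSpace X] {Y : Type*} {f : X → Y}
    (hf : IsLocallyInjective f) (hN : N ≤ deckGroup f) {g : K} (hg : descend hKN g = 1) :
    (g : HolAut X) ∈ N := by
  have fix (x : X) : ∃ n ∈ N, n • x = (g : HolAut X) • x := by
    rw [← orbitMk_eq_iff, ← descend_smul_orbitMk hKN, hg, one_smul]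
  have hdeck : (g : HolAut X) ∈ deckGroup f := fun x => by
    obtain ⟨n, hn, e⟩ := fix x
    rw [← e, hN hn]
  obtain ⟨x⟩ : Nonempty X := inferInstance
  obtain ⟨n, hn, e⟩ := fix x
  rwa [← eq_of_mem_deckGroup hf (hN hn) hdeck e]

end Descent

end RSurf

/-! ### Group theory: lifts of a presentation and the splitting modulo `N` -/

section LiftedPresentation

variable {G L J I : Type*} [Group G] [Group L] (P : GroupPresentation L J I) {θ : G →* L}
  {ψ : J → G}

lemma lift_comp_lift_eq (hψ : ∀ j, θ (ψ j) = P.gen j) :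
    θ.comp (FreeGroup.lift ψ) = FreeGroup.lift P.gen :=
  FreeGroup.ext_hom _ _ fun j => by
    rw [MonoidHom.comp_apply, FreeGroup.lift_apply_of, FreeGroup.lift_apply_of, hψ]

lemma map_closure_range_eq_top (hψ : ∀ j, θ (ψ j) = P.gen j) :
    (Subgroup.closure (Set.range ψ)).map θ = ⊤ := by
  rw [MonoidHom.map_closure, ← Set.range_comp, ← P.closure_gen]
  exact congrArg _ (congrArg _ (funext hψ))

/-- The elements of the kernel of `θ` in the group generated by lifts of the generators lie in
every normal subgroup containing the values of the relators. -/
lemma ker_inf_closure_le (hψ : ∀ j, θ (ψ j) = P.gen j) {N : Subgroup G} [N.Normal]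
    (hrel : ∀ i, FreeGroup.lift ψ (P.rel i) ∈ N) :
    θ.ker ⊓ Subgroup.closure (Set.range ψ) ≤ N := by
  rintro b ⟨hb, hb'⟩
  rw [← FreeGroup.range_lift_eq_closure] at hb'
  obtain ⟨w, rfl⟩ := hb'
  have hw : w ∈ Subgroup.normalClosure (Set.range P.rel) := by
    rw [← P.ker_lift, ← lift_comp_lift_eq P hψ]
    exact hb
  have : Subgroup.normalClosure (Set.range P.rel) ≤ N.comap (FreeGroup.lift ψ) := by
    refine Subgroup.normalClosure_le_normal ?_
    rintro _ ⟨i, rfl⟩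
    exact hrel i
  exact this hw

/-- If the kernel of `θ` is abelian, then its intersection with a subgroup mapping onto the target
is normal. -/
lemma conj_mem_ker_inf (hcomm : ∀ a ∈ θ.ker, ∀ b ∈ θ.ker, a * b = b * a) {B : Subgroup G}
    (hB : B.map θ = ⊤) (g : G) {n : G} (hn : n ∈ θ.ker ⊓ B) : g * n * g⁻¹ ∈ θ.ker ⊓ B := by
  obtain ⟨b, hb, e⟩ : θ g ∈ B.map θ := hB ▸ Subgroup.mem_top _
  -- `g` differs from `b` by an element of the abelian kernel, which centralizes `n`; so both
  -- conjugate `n` alike.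
  have hm : b⁻¹ * g ∈ θ.ker := by rw [MonoidHom.mem_ker, map_mul, map_inv, e, inv_mul_cancel]
  have key : g * n * g⁻¹ = b * n * b⁻¹ := by
    calc g * n * g⁻¹ = b * ((b⁻¹ * g) * n) * (b⁻¹ * g)⁻¹ * b⁻¹ := by group
      _ = b * n * b⁻¹ := by rw [hcomm _ hm _ hn.1]; group
  exact ⟨θ.normal_ker.conj_mem n hn.1 g,
    key ▸ B.mul_mem (B.mul_mem hb hn.2) (B.inv_mem hb)⟩

variable {N : Subgroup G} [N.Normal] {B : Subgroup G}

/-- If `a ∈ θ.ker` and `b ∈ B` agree modulo `N`, then `b` is in the kernel too, so in `N`. To factor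
`g`, choose `b ∈ B` with the same image and write `g = (g * b⁻¹) * b`. -/
lemma isComplement'_map_mk (hN : N ≤ θ.ker) (hB : B.map θ = ⊤) (hBN : θ.ker ⊓ B ≤ N) :
    Subgroup.IsComplement' (θ.ker.map (QuotientGroup.mk' N)) (B.map (QuotientGroup.mk' N)) := by
  refine Subgroup.isComplement'_of_disjoint_and_mul_eq_univ ?_ ?_
  · rw [Subgroup.disjoint_def]
    rintro _ ⟨a, ha, rfl⟩ ⟨b, hb, e⟩
    have hab : b⁻¹ * a ∈ N := QuotientGroup.eq.1 e
    have hbk : b ∈ θ.ker := by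
      have := hN hab
      rwa [MonoidHom.mem_ker, map_mul, MonoidHom.mem_ker.1 ha, mul_one, map_inv, inv_eq_one] at this
    rw [← e]
    exact (QuotientGroup.eq_one_iff b).2 (hBN ⟨hbk, hb⟩)
  · refine Set.eq_univ_of_forall fun x => ?_
    obtain ⟨g, rfl⟩ := QuotientGroup.mk'_surjective N x
    obtain ⟨b, hb, e⟩ : θ g ∈ B.map θ := hB ▸ Subgroup.mem_top _
    refine Set.mem_mul.2 ⟨_, ⟨g * b⁻¹, ?_, rfl⟩, _, ⟨b, hb, rfl⟩, ?_⟩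
    · change g * b⁻¹ ∈ θ.ker
      rw [MonoidHom.mem_ker, map_mul, map_inv, e, mul_inv_cancel]
    · rw [← map_mul, inv_mul_cancel_right]

lemma exists_mulEquiv_map_mk (hN : N ≤ θ.ker) (hB : B.map θ = ⊤) (hBN : θ.ker ⊓ B ≤ N) :
    ∃ e : B.map (QuotientGroup.mk' N) ≃* L,
      ∀ (g : G) (hg : QuotientGroup.mk g ∈ B.map (QuotientGroup.mk' N)),
        e ⟨QuotientGroup.mk g, hg⟩ = θ g := by
  let F : B.map (QuotientGroup.mk' N) →* L :=
    (QuotientGroup.lift N θ hN).comp (Subgroup.subtype _)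
  refine ⟨MulEquiv.ofBijective F ⟨?_, fun l => ?_⟩, fun g hg => rfl⟩
  · rw [injective_iff_map_eq_one]
    rintro ⟨_, b, hb, rfl⟩ h
    exact Subtype.ext ((QuotientGroup.eq_one_iff b).2 (hBN ⟨h, hb⟩))
  · obtain ⟨b, hb, e⟩ : l ∈ B.map θ := hB ▸ Subgroup.mem_top _
    exact ⟨⟨_, b, hb, rfl⟩, e⟩

end LiftedPresentation

namespace RSurf

/-! ### Application to the `k`-homology cover -/

section HomologyCover

variable {U S : Type*} [TopologicalSpace S] [ChartedSpace ℂ S]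
  [TopologicalSpace U] [ChartedSpace ℂ U] (p : UniversalCovering U S) (k : ℕ∞)

lemma isLocalHomeomorph_homologyProj : IsLocalHomeomorph (homologyProj p k) :=
  isLocalHomeomorph_orbitLift p.isCoveringMap.isLocalHomeomorph _

lemma t2Space_homologyCover [T2Space S] [T2Space U] : T2Space (HomologyCover p k) :=
  have := ChartedSpace.locallyConnectedSpace ℂ S
  t2Space_orbitSpace p.isCoveringMap.isLocalHomeomorph (commPow_le _ k)

lemma commute_of_mem_deckM [T2Space U] {a b : HolAut (HomologyCover p k)} (ha : a ∈ deckM p k)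
    (hb : b ∈ deckM p k) : a * b = b * a :=
  have := p.simplyConnected
  have : IsEtaleAction (commPow (deckGroup p.toFun) k) := isEtaleAction_commPow p k
  commute_of_mem_deckGroup_orbitLift (commPow_le _ k)
    (isCoveringMap_orbitMk p.isCoveringMap.isLocalHomeomorph.isLocallyInjective (commPow_le _ k))
    (fun a ha b hb => Subgroup.subset_closure (.inl ⟨a, ha, b, hb, rfl⟩)) ha hb

/-- Surjectivity of `homologyProj` makes the automorphism below a lift unique, so the choice made in
`theta` has no effect. -/
lemma ker_thetaK (L : Subgroup (HolAut S)) :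
    (thetaK p k L).ker = (deckM p k).subgroupOf (liftL p k L) := by
  ext g
  rw [MonoidHom.mem_ker, Subgroup.mem_subgroupOf]
  refine ⟨mem_deckGroup_of_theta_eq_one (homologyProj_surjective p k), fun hg => ?_⟩
  refine Subtype.ext (holAut_ext fun s => ?_)
  obtain ⟨x, rfl⟩ := homologyProj_surjective p k s
  exact (theta_spec (homologyProj_surjective p k) g x).symm.trans
    ((hg x).trans (one_smul (HolAut S) _).symm)

variable {L : Subgroup (HolAut S)} {J I : Type*} (P : GroupPresentation L J I)
  (ψ : J → liftL p k L) (hψ : ∀ j, thetaK p k L (ψ j) = P.gen j)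

lemma isLeast_relatorSubgroup :
    IsLeast (invariantSubgroups p k P ψ hψ) (relatorSubgroup p k P ψ hψ) :=
  ⟨⟨relatorSubgroup_le p k P ψ hψ,
    fun g hg n hn => Subgroup.mem_sInf.2 fun N hN => hN.2.1 g hg n (Subgroup.mem_sInf.1 hn N hN),
    fun i => Subgroup.mem_sInf.2 fun _ hN => hN.2.2 i⟩, fun _ hN => sInf_le hN⟩

lemma relatorN_le_ker : relatorN p k P ψ hψ ≤ (thetaK p k L).ker := by
  rw [ker_thetaK]
  exact Subgroup.comap_mono (relatorSubgroup_le p k P ψ hψ)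

lemma lift_rel_mem_relatorN (i : I) : FreeGroup.lift ψ (P.rel i) ∈ relatorN p k P ψ hψ :=
  (isLeast_relatorSubgroup p k P ψ hψ).1.2.2 i

/-- By minimality it suffices that `θ.ker ⊓ B` is itself an admissible subgroup; cutting down to the
kernel puts it in `M_k` and makes commutativity available for its invariance. -/
lemma relatorN_le_closure [T2Space U] :
    relatorN p k P ψ hψ ≤ Subgroup.closure (Set.range ψ) := by
  set B := Subgroup.closure (Set.range ψ) with hB
  have hcomm : ∀ a ∈ (thetaK p k L).ker, ∀ b ∈ (thetaK p k L).ker, a * b = b * a := by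
    rw [ker_thetaK]
    exact fun a ha b hb => Subtype.ext (commute_of_mem_deckM p k ha hb)
  have hmem : ((thetaK p k L).ker ⊓ B).map (liftL p k L).subtype
      ∈ invariantSubgroups p k P ψ hψ := by
    refine ⟨?_, ?_, fun i => ⟨FreeGroup.lift ψ (P.rel i), ⟨?_, ?_⟩, rfl⟩⟩
    · rintro _ ⟨n, hn, rfl⟩
      have := hn.1
      rw [ker_thetaK] at this
      exact this
    · rintro g hg _ ⟨n, hn, rfl⟩
      exact ⟨_, conj_mem_ker_inf hcomm (map_closure_range_eq_top P hψ) ⟨g, hg⟩ hn, rfl⟩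
    · exact relatorN_le_ker p k P ψ hψ (lift_rel_mem_relatorN p k P ψ hψ i)
    · rw [hB, ← FreeGroup.range_lift_eq_closure]
      exact ⟨_, rfl⟩
  intro n hn
  obtain ⟨m, hm, e⟩ := (isLeast_relatorSubgroup p k P ψ hψ).2 hmem hn
  rw [← Subtype.ext e]
  exact hm.2

end HomologyCover

end RSurf

theorem theorem6 {U S : Type*}
    [TopologicalSpace S] [ChartedSpace ℂ S] [RiemannSurface S] (hS : IsNonExceptional S)
    [TopologicalSpace U] [ChartedSpace ℂ U] [RiemannSurface U] (p : UniversalCovering U S)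
    (k : ℕ∞) (hk : 2 ≤ k) (L : Subgroup (HolAut S))
    {J I : Type*} (P : GroupPresentation L J I)
    (ψ : J → liftL p k L) (hψ : ∀ j, thetaK p k L (ψ j) = P.gen j) :
    -- the relator subgroup is the least invariant subgroup of `M_k` containing the `m_i`,
    -- and it lies in the subgroup generated by the lifts
    IsLeast (invariantSubgroups p k P ψ hψ) (relatorSubgroup p k P ψ hψ) ∧
    relatorN p k P ψ hψ ≤ Subgroup.closure (Set.range ψ) ∧
    -- `W` is a Riemann surface, holomorphically covered by the `k`-homology cover
    RiemannSurface (QuotientSurface p k P ψ hψ) ∧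
    IsCoveringMap (orbitMk (relatorSubgroup p k P ψ hψ)) ∧
    ContMDiff 𝓘(ℂ) 𝓘(ℂ) ω (orbitMk (relatorSubgroup p k P ψ hψ)) ∧
    -- `G` is a group of automorphisms of `W`
    (∃ ρ : QuotientGroupG p k P ψ hψ →* HolAut (QuotientSurface p k P ψ hψ),
      Function.Injective ρ ∧
      ∀ (g : liftL p k L) (x : HomologyCover p k),
        ρ (QuotientGroup.mk g) • orbitMk (relatorSubgroup p k P ψ hψ) x =
          orbitMk (relatorSubgroup p k P ψ hψ) ((g : HolAut (HomologyCover p k)) • x)) ∧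
    -- `G` is the internal semidirect product of `A` and `L̂`
    (subgroupA p k P ψ hψ).Normal ∧
    Subgroup.IsComplement' (subgroupA p k P ψ hψ) (subgroupLhat p k P ψ hψ) ∧
    -- and `L̂` is isomorphic to `L`, compatibly with the choice of the lifts
    (∃ e : subgroupLhat p k P ψ hψ ≃* L,
      ∀ (j : J) (hj : QuotientGroup.mk (ψ j) ∈ subgroupLhat p k P ψ hψ),
        e ⟨QuotientGroup.mk (ψ j), hj⟩ = P.gen j) := by
  have := t2Space_homologyCover p k
  have := ChartedSpace.locallyConnectedSpace ℂ S
  have hinj := homologyProj_isLocallyInjective p k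
  have hleast := isLeast_relatorSubgroup p k P ψ hψ
  have hle := relatorSubgroup_le p k P ψ hψ
  have hker := relatorN_le_ker p k P ψ hψ
  have htop := map_closure_range_eq_top P hψ
  have hinf := ker_inf_closure_le P hψ (lift_rel_mem_relatorN p k P ψ hψ)
  have hA : subgroupA p k P ψ hψ =
      (thetaK p k L).ker.map (QuotientGroup.mk' (relatorN p k P ψ hψ)) := by
    rw [ker_thetaK, subgroupA]
  refine ⟨hleast, relatorN_le_closure p k P ψ hψ, ?_, isCoveringMap_orbitMk hinj hle,
    contMDiff_orbitMk _, ?_, ?_, ?_, ?_⟩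
  -- Hausdorffness is inherited through the local homeomorphism to `S`; connectedness and the
  -- holomorphic atlas are found as instances.
  · have := t2Space_orbitSpace (isLocalHomeomorph_homologyProj p k) hle
    exact {}
  · refine ⟨QuotientGroup.lift (relatorN p k P ψ hψ) (descend hleast.1.2.1)
      fun g hg => descend_eq_one_of_mem _ hg, ?_, fun g x => rfl⟩
    rw [injective_iff_map_eq_one]
    intro x hx
    obtain ⟨g, rfl⟩ := QuotientGroup.mk_surjective x
    exact (QuotientGroup.eq_one_iff g).2 (mem_of_descend_eq_one hleast.1.2.1 hinj hle hx)
  · rw [hA]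
    exact (thetaK p k L).normal_ker.map _ (QuotientGroup.mk'_surjective _)
  · rw [hA]
    exact isComplement'_map_mk hker htop hinf
  · obtain ⟨e, he⟩ := exists_mulEquiv_map_mk hker htop hinf
    exact ⟨e, fun j hj => (he (ψ j) hj).trans (hψ j)⟩
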